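/- Let $A$ be a finite alphabet and let $\pi$ be a probability distribution on $A$ with $0<\pi(a)<1$ for every $a\in A$. Let $\alpha\in A$, $m\ge 1$, and let $X=\alpha^m$ be the word consisting of $m$ copies of $\alpha$. Consider the following algorithm, which counts the occurrences of $X=X[0]\cdots X[m-1]$ in a text $W=W[0]\cdots W[n-1]$ over $A$, where the table $B$ is either the Morris–Pratt table or the Knuth–Morris–Pratt table of $X$: - initialize $i,j,nb\leftarrow 0,0,0$; - while $j<n$: first, while $i\ge 0$ and $X[i]\ne W[j]$, set $i\leftarrow B[i]$; then set $i,j\leftarrow i+1,j+1$; then, if $i=m$, set $i\leftarrow B[i]$ and $nb\leftarrow nb+1$; - return $nb$. Here $B[i]=|b(u_i)|$, with $u_i$ the prefix of $X$ of length $i$ ($0\le i\le m$), and $|\bot|=-1$. A strict border of a word $u$ is a word that is both a strict prefix and a strict suffix of $u$. For Morris–Pratt, $b(u)$ is the longest strict border of $u$, with $b(\varepsilon)=\bot$. For Knuth–Morris–Pratt, $b(X)$ is the longest strict border of $X$, and for a strict prefix $u$ of $X$, with $ua$ a prefix of $X$ ($a\in A$), $b(u)$ is the longest strict border $v$ of $u$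 such that $va$ is not a prefix of $X$, and $b(u)=\bot$ if there is none. The branch "if $i=m$" (the update of the occurrence counter) has its own 2-bit saturated predictor. The predictor has four states $\underline\nu,\nu,\tau,\underline\tau$, in this order from left to right; it predicts "not taken" in $\underline\nu,\nu$ and "taken" in $\tau,\underline\tau$. After each evaluation of the test it moves one step to the right if the test is true (taken) and one step to the left if it is false (not taken), staying in place if there is no further state in that direction. A misprediction occurs whenever the outcome differs from the prediction. Let $E_n$ be the expected number of mispredictions of this branch when $W$ is a random text of $n$ independent letters with distribution $\pi$, the predictor starting in an arbitrary fixed state. Then, for both tables $B$ and every initial state, $$E_n\sim \kappa_m(\pi(\alpha))\cdot n\qquad (n\to\infty),$$ where $$\kappa_1(p)=\frac{p(1-p)}{1-2p(1-p)},\qquad \kappa_2(p)=\frac{p^2(1-p)(1+2p+p^2-p^3)}{1-p^3+p^4},\qquad \kappa_m(p)=p^m(1-p)(1+p)^2\quad (m\ge 3).$$ -/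

import Mathlib

namespace PatternMatching

/-! ### Failure functions -/

section Failure

/-- The length of a word, with the convention `|⊥| = -1`. -/
def optLength {A : Type*} : Option (List A) → ℤ
  | none => -1
  | some v => v.length

theorem optLength_lt {A : Type*} {o : Option (List A)} {X : List A} {i : ℕ}
    (h : ∀ v, o = some v → v.length < (X.take i).length) : optLength o < i := by
  cases o with
  | none => simp only [optLength]; omega
  | some v =>
    have h1 := h v rfl
    have h2 := List.length_take_le i X
    simp only [optLength]
    omega

variable {A : Type*} [DecidableEq A]

/-- The strict borders of `u`: the words that are both a strict prefix and a strict suffix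
of `u`. -/
def strictBorders (u : List A) : List (List A) :=
  u.inits.filter (fun v => v ≠ u ∧ v <:+ u)

/-- The failure function of Morris-Pratt: the longest strict border of `u`, and `none`
(written `⊥` on paper) if `u` is empty. -/
def mp (u : List A) : Option (List A) :=
  (strictBorders u).argmax List.length

/-- The failure function of Knuth-Morris-Pratt for the pattern `X`: it agrees with `mp` on `X`
itself, and a strict prefix `u` of `X`, followed by the letter `a` in `X`, is mapped to
the longest strict border `v` of `u` such that `v a` is not a prefix of `X`,
or to `none` (that is `⊥`) if there is no such border. -/
def kmp (X u : List A) : Option (List A) :=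
  if u = X then mp u
  else ((strictBorders u).filter
    (fun v => ∀ a ∈ X, u ++ [a] <+: X → ¬ v ++ [a] <+: X)).argmax List.length

/-- A table of integers `B[0], B[1], …` with `B[i] < i`. The inequality is recorded because it
makes the inner loop of the algorithm terminate. -/
structure FailureTable where
  val : ℕ → ℤ
  lt : ∀ i : ℕ, val i < i

theorem length_lt_of_mem_strictBorders {u v : List A} (h : v ∈ strictBorders u) :
    v.length < u.length := by
  simp only [strictBorders, List.mem_filter, List.mem_inits, decide_eq_true_eq] at h
  obtain ⟨h1, h2, -⟩ := h
  exact lt_of_le_of_ne h1.length_le (fun h3 => h2 (h1.eq_of_length h3))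

theorem length_lt_of_mp {u v : List A} (h : mp u = some v) : v.length < u.length :=
  length_lt_of_mem_strictBorders (List.argmax_mem h)

theorem length_lt_of_kmp {X u v : List A} (h : kmp X u = some v) : v.length < u.length := by
  unfold kmp at h
  split_ifs at h with hu
  · exact length_lt_of_mp h
  · exact length_lt_of_mem_strictBorders (List.mem_filter.1 (List.argmax_mem h)).1

/-- The table `B[i] = |mp (pref (X, i))|` used by the Morris-Pratt algorithm. -/
def mpTable (X : List A) : FailureTable where
  val i := optLength (mp (X.take i))
  lt _ := optLength_lt (fun _ h => length_lt_of_mp h)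

/-- The table `B[i] = |kmp_X (pref (X, i))|` used by the Knuth-Morris-Pratt algorithm. -/
def kmpTable (X : List A) : FailureTable where
  val i := optLength (kmp X (X.take i))
  lt _ := optLength_lt (fun _ h => length_lt_of_kmp h)

end Failure

/-! ### The pattern matching algorithm

```
m, n ← |X|, |W|
i, j, nb ← 0, 0, 0
while j < n
    while i ≥ 0 and X[i] ≠ W[j]
        i ← B[i]
    i, j ← i + 1, j + 1
    if i = m
        i ← B[i]
        nb ← nb + 1
return nb
```
-/

section Algorithm

variable {A : Type*} [DecidableEq A]

/-- The inner loop `while i ≥ 0 and X[i] ≠ c do i ← B[i]`, where `c = W[j]` is the current letter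
of the text; returns the value of `i` at the exit of the loop. -/
def innerLoop (X : List A) (B : FailureTable) (c : A) (i : ℤ) : ℤ :=
  if 0 ≤ i ∧ X[i.toNat]? ≠ some c then innerLoop X B c (B.val i.toNat) else i
termination_by (i + 1).toNat
decreasing_by
  have := B.lt i.toNat
  omega

/-- The main loop, entered with the given values of `i` and `nb`, on the letters of the text
that have not been read yet. It returns the final value of `nb` together with the list of the
successive outcomes of the test `i = m` (`true` for "taken", `false` for "not taken"). -/
def mainLoop (X : List A) (B : FailureTable) : ℤ → ℕ → List A → ℕ × List Bool
  | _, nb, [] => (nb, [])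
  | i, nb, c :: W =>
    let i' := innerLoop X B c i + 1
    if i' = X.length then
      let r := mainLoop X B (B.val X.length) (nb + 1) W
      (r.1, true :: r.2)
    else
      let r := mainLoop X B i' nb W
      (r.1, false :: r.2)

/-- The algorithm `FIND(X, W, B)`: the number of occurrences found, and the successive outcomes of
the branch `i = m`. -/
def find (X W : List A) (B : FailureTable) : ℕ × List Bool :=
  mainLoop X B 0 0 W

end Algorithm

/-! ### The 2-bit saturated predictor -/

/-- The four states of the 2-bit saturated counter. -/
inductive PredictorState where
  | stronglyNotTaken
  | weaklyNotTaken
  | weaklyTaken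
  | stronglyTaken

namespace PredictorState

/-- The outcome predicted in a state (`true` for "taken"). -/
def prediction : PredictorState → Bool
  | stronglyNotTaken => false
  | weaklyNotTaken => false
  | weaklyTaken => true
  | stronglyTaken => true

/-- The new state, after the outcome of the branch is known. -/
def next : PredictorState → Bool → PredictorState
  | stronglyNotTaken, true => weaklyNotTaken
  | weaklyNotTaken, true => weaklyTaken
  | weaklyTaken, true => stronglyTaken
  | stronglyTaken, true => stronglyTaken
  | stronglyNotTaken, false => stronglyNotTaken
  | weaklyNotTaken, false => stronglyNotTaken
  | weaklyTaken, false => weaklyNotTaken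
  | stronglyTaken, false => weaklyTaken

/-- The number of mispredictions along a sequence of outcomes, from a given state. -/
def mispredictions : PredictorState → List Bool → ℕ
  | _, [] => 0
  | s, b :: l => (if s.prediction = b then 0 else 1) + mispredictions (s.next b) l

end PredictorState

/-! ### Random texts -/

section Random

variable {A : Type*}

/-- The number of mispredictions of the branch `i = m` (the update of the occurrence counter) when
the algorithm is run on the pattern `X` and the text `W` with the table `B`, the local predictor of
that branch being initially in state `s`. -/
def counterMispredictions [DecidableEq A] (X : List A) (B : FailureTable) (s : PredictorState)
    (W : List A) : ℕ :=
  s.mispredictions (find X W B).2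

/-- The expectation of `f W` for a random text `W` of length `n` whose letters are independent with
distribution `π`: the text `W` has probability `π(W₀) ⋯ π(Wₙ₋₁)`. -/
noncomputable def textExpectation [Fintype A] (π : A → ℝ) (n : ℕ) (f : List A → ℝ) : ℝ :=
  ∑ W : Fin n → A, (∏ i, π (W i)) * f (List.ofFn W)

/-- The expected number of mispredictions of the branch `i = m` on a random text of length `n`. -/
noncomputable def expectedCounterMispredictions [Fintype A] [DecidableEq A] (π : A → ℝ)
    (X : List A) (B : FailureTable) (s : PredictorState) (n : ℕ) : ℝ :=
  textExpectation π n (fun W => (counterMispredictions X B s W : ℝ))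

end Random

/-- The constant `κ_m(p)`, for `m ≥ 1` (the value for `m = 0` is irrelevant). -/
noncomputable def kappa (m : ℕ) (p : ℝ) : ℝ :=
  if m = 1 then p * (1 - p) / (1 - 2 * p * (1 - p))
  else if m = 2 then p ^ 2 * (1 - p) * (1 + 2 * p + p ^ 2 - p ^ 3) / (1 - p ^ 3 + p ^ 4)
  else p ^ m * (1 - p) * (1 + p) ^ 2

end PatternMatching

namespace PatternMatching

open PredictorState

/-! ### Failure tables of the pattern `α ^ m` -/

section Tables

/-! On `α ^ m` both tables act alike: reading `α` advances `i`, any other letter resets it to `0`,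
and a completed occurrence returns it to `m - 1`. So `i` and the predictor form a finite Markov
chain driven by a coin of bias `p = π α`. Its mean cost comes from a Poisson equation: for a
potential `h` solving it with mean cost `g`, induction on `n` keeps the expected cost within a
constant of `n * g`, from any initial state (`IsPoissonSolution.abs_textExpectation_sub_le`). As
`kappa` is positive, this gives the equivalence. What remains is an explicit potential for `m = 1`,
`m = 2` and `m ≥ 3`.

For `m ≥ 3`, at least three outcomes "not taken" separate a mismatch from the next "taken", so the
predictor has saturated. A run of `α` with at least one, two, three occurrences then adds `1`, `2`,
`1` mispredictions, whence `p ^ m * (1 - p) * (1 + 2 * p + p ^ 2)`. -/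

theorem neg_one_le_optLength {A : Type*} (o : Option (List A)) : -1 ≤ optLength o := by
  cases o <;> simp only [optLength] <;> omega

variable {A : Type*} [DecidableEq A]

theorem replicate_mem_strictBorders (α : A) (k : ℕ) :
    List.replicate k α ∈ strictBorders (List.replicate (k + 1) α) := by
  simp only [strictBorders, List.mem_filter, List.mem_inits, decide_eq_true_eq]
  refine ⟨⟨[α], ?_⟩, ?_, ⟨[α], ?_⟩⟩
  · rw [List.replicate_succ']
  · intro h
    simpa using congrArg List.length h
  · rw [List.replicate_succ]
    rfl

theorem optLength_mp_replicate (α : A) (k : ℕ) :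
    optLength (mp (List.replicate (k + 1) α)) = k := by
  cases h : mp (List.replicate (k + 1) α) with
  | none =>
    have h0 := replicate_mem_strictBorders α k
    rw [mp, List.argmax_eq_none] at h
    simp [h] at h0
  | some v =>
    have h1 := length_lt_of_mp h
    have h2 := List.le_of_mem_argmax (replicate_mem_strictBorders α k) h
    simp only [List.length_replicate] at h1 h2
    simp only [optLength]
    omega

theorem mpTable_replicate_val_length (α : A) (k : ℕ) :
    (mpTable (List.replicate (k + 1) α)).val (k + 1) = k := by
  have h : (List.replicate (k + 1) α).take (k + 1) = List.replicate (k + 1) α := by simp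
  simp only [mpTable, h, optLength_mp_replicate]

theorem kmpTable_replicate_val_length (α : A) (k : ℕ) :
    (kmpTable (List.replicate (k + 1) α)).val (k + 1) = k := by
  have h : (List.replicate (k + 1) α).take (k + 1) = List.replicate (k + 1) α := by simp
  simp only [kmpTable, h, kmp, if_true, optLength_mp_replicate]

end Tables

/-! ### Execution of the algorithm on the pattern `α ^ m` -/

section Execution

variable {A : Type*} [DecidableEq A]

theorem innerLoop_replicate_self (α : A) (B : FailureTable) {m i : ℕ} (hi : i < m) :
    innerLoop (List.replicate m α) B α i = i := by
  rw [innerLoop]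
  simp [hi]

/-- Every position of the pattern carries `α`, so the comparison keeps failing while `i` decreases.
The auxiliary `n` bounds `i` for the induction. -/
theorem innerLoop_replicate_of_ne {α c : A} (hc : c ≠ α) {B : FailureTable}
    (hB : ∀ i, -1 ≤ B.val i) {m : ℕ} (n : ℕ) (i : ℤ) (hi : -1 ≤ i) (hin : i < n) (hnm : n ≤ m) :
    innerLoop (List.replicate m α) B c i = -1 := by
  induction n generalizing i with
  | zero =>
    obtain rfl : i = -1 := by omega
    rw [innerLoop]
    simp
  | succ n ih =>
    rcases lt_or_ge i 0 with h0 | h0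
    · exact ih i hi (by omega) (by omega)
    · rw [innerLoop, if_pos]
      · have h1 := B.lt i.toNat
        exact ih _ (hB _) (by omega) (by omega)
      · refine ⟨h0, ?_⟩
        rw [List.getElem?_replicate_of_lt (by omega)]
        simpa using hc.symm

variable {α : A} {B : FailureTable} {M : ℕ}

theorem mainLoop_replicate_cons_self_of_lt {i : ℕ} (hi : i < M) (nb : ℕ) (W : List A) :
    (mainLoop (List.replicate (M + 1) α) B i nb (α :: W)).2 =
      false :: (mainLoop (List.replicate (M + 1) α) B (i + 1 : ℕ) nb W).2 := by
  have h : ¬ ((i : ℤ) + 1 = (M + 1 : ℕ)) := by omega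
  simp only [mainLoop, innerLoop_replicate_self α B (show i < M + 1 by omega),
    List.length_replicate, if_neg h]
  push_cast
  rfl

theorem mainLoop_replicate_cons_self (hBM : B.val (M + 1) = M) (nb : ℕ) (W : List A) :
    (mainLoop (List.replicate (M + 1) α) B M nb (α :: W)).2 =
      true :: (mainLoop (List.replicate (M + 1) α) B M (nb + 1) W).2 := by
  have h : (M : ℤ) + 1 = (M + 1 : ℕ) := by omega
  simp only [mainLoop, innerLoop_replicate_self α B (show M < M + 1 by omega),
    List.length_replicate, if_pos h, hBM]

theorem mainLoop_replicate_cons_of_ne (hB : ∀ i, -1 ≤ B.val i) {c : A} (hc : c ≠ α) {i : ℕ}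
    (hi : i ≤ M) (nb : ℕ) (W : List A) :
    (mainLoop (List.replicate (M + 1) α) B i nb (c :: W)).2 =
      false :: (mainLoop (List.replicate (M + 1) α) B (0 : ℕ) nb W).2 := by
  have h : ¬ ((-1 : ℤ) + 1 = (M + 1 : ℕ)) := by omega
  simp only [mainLoop, innerLoop_replicate_of_ne hc hB (M + 1) (i : ℤ) (by omega) (by omega) le_rfl,
    List.length_replicate, if_neg h]
  rfl

end Execution

/-! ### Expectations over random texts -/

section Expectation

variable {A : Type*} [Fintype A]

theorem textExpectation_zero (π : A → ℝ) (f : List A → ℝ) : textExpectation π 0 f = f [] := by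
  simp [textExpectation]

theorem textExpectation_succ (π : A → ℝ) (n : ℕ) (f : List A → ℝ) :
    textExpectation π (n + 1) f = ∑ a, π a * textExpectation π n (fun W => f (a :: W)) := by
  simp only [textExpectation, Finset.mul_sum]
  rw [← (Fin.consEquiv (fun _ : Fin (n + 1) => A)).sum_comp, Fintype.sum_prod_type]
  refine Finset.sum_congr rfl fun a _ => Finset.sum_congr rfl fun W _ => ?_
  simp [Fin.consEquiv, Fin.prod_univ_succ, List.ofFn_succ, mul_assoc]

theorem textExpectation_add_const {π : A → ℝ} (hπ : ∑ a, π a = 1) (c : ℝ) (n : ℕ)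
    (f : List A → ℝ) :
    textExpectation π n (fun W => c + f W) = c + textExpectation π n f := by
  induction n generalizing f with
  | zero => simp only [textExpectation_zero]
  | succ n ih =>
    simp only [textExpectation_succ, ih, mul_add, Finset.sum_add_distrib, ← Finset.sum_mul, hπ,
      one_mul]

/-- Reduces the alphabet to two outcomes, `α` or not `α`. -/
theorem sum_mul_eq_of_forall_ne [DecidableEq A] {π : A → ℝ} (hπ : ∑ a, π a = 1) (α : A)
    {F : A → ℝ} {v : ℝ} (h : ∀ a, a ≠ α → F a = v) :
    ∑ a, π a * F a = π α * F α + (1 - π α) * v := by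
  rw [← hπ, ← Finset.add_sum_erase _ _ (Finset.mem_univ α),
    ← Finset.add_sum_erase Finset.univ π (Finset.mem_univ α), add_sub_cancel_left, Finset.sum_mul]
  congr 1
  exact Finset.sum_congr rfl fun a ha => by rw [h a (Finset.ne_of_mem_erase ha)]

end Expectation

/-! ### The Poisson equation -/

/-- The cost of the outcome `b` in the state `s`: `1` for a misprediction, `0` otherwise. -/
def missCost (s : PredictorState) (b : Bool) : ℝ := if s.prediction = b then 0 else 1

theorem cast_mispredictions_cons (s : PredictorState) (b : Bool) (l : List Bool) :
    (s.mispredictions (b :: l) : ℝ) = missCost s b + ((s.next b).mispredictions l : ℝ) := by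
  simp only [mispredictions, missCost]
  split_ifs <;> simp

/-- `h` solves the Poisson equation, with mean cost `g`, of the Markov chain that runs the
algorithm on the pattern `α ^ (M + 1)` together with the predictor, where `p` is the probability
of the letter `α`. -/
structure IsPoissonSolution (M : ℕ) (p g : ℝ) (h : ℕ → PredictorState → ℝ) : Prop where
  of_lt : ∀ i < M, ∀ s, h i s + g =
    p * (missCost s false + h (i + 1) (s.next false)) +
      (1 - p) * (missCost s false + h 0 (s.next false))
  last : ∀ s, h M s + g =
    p * (missCost s true + h M (s.next true)) +
      (1 - p) * (missCost s false + h 0 (s.next false))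

theorem exists_forall_abs_le (M : ℕ) (h : ℕ → PredictorState → ℝ) :
    ∃ C, ∀ i ≤ M, ∀ s, |h i s| ≤ C := by
  refine ⟨∑ i ∈ Finset.range (M + 1), (|h i stronglyNotTaken| + |h i weaklyNotTaken| +
    |h i weaklyTaken| + |h i stronglyTaken|), fun i hi s => ?_⟩
  refine le_trans ?_ (Finset.single_le_sum (f := fun i => |h i stronglyNotTaken| +
    |h i weaklyNotTaken| + |h i weaklyTaken| + |h i stronglyTaken|)
    (fun _ _ => by positivity) (Finset.mem_range.2 (Nat.lt_succ_of_le hi)))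
  have h1 := abs_nonneg (h i stronglyNotTaken)
  have h2 := abs_nonneg (h i weaklyNotTaken)
  have h3 := abs_nonneg (h i weaklyTaken)
  have h4 := abs_nonneg (h i stronglyTaken)
  cases s <;> linarith

section Poisson

variable {A : Type*} [Fintype A] [DecidableEq A]

/-- Conditioning on the first letter, the Poisson equation makes the deviation at `n + 1` a convex
combination of two deviations at `n`, so the bound does not grow. -/
theorem IsPoissonSolution.abs_textExpectation_sub_le {π : A → ℝ} (hπ_pos : ∀ a, 0 < π a)
    (hπ_lt : ∀ a, π a < 1) (hπ : ∑ a, π a = 1) {α : A} {M : ℕ} {g C : ℝ}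
    {h : ℕ → PredictorState → ℝ} (hh : IsPoissonSolution M (π α) g h)
    (hC : ∀ i ≤ M, ∀ s, |h i s| ≤ C) {B : FailureTable} (hB : ∀ i, -1 ≤ B.val i)
    (hBM : B.val (M + 1) = M) (n : ℕ) {i : ℕ} (hi : i ≤ M) (nb : ℕ) (s : PredictorState) :
    |textExpectation π n (fun W =>
      (s.mispredictions (mainLoop (List.replicate (M + 1) α) B i nb W).2 : ℝ)) -
        n * g - h i s| ≤ C := by
  induction n generalizing i nb s with
  | zero =>
    simpa [textExpectation_zero, mainLoop, mispredictions] using hC i hi s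
  | succ n ih =>
    have hp := (hπ_pos α).le
    have hq := (hπ_lt α).le
    have key : ∀ {x y x' y' : ℝ}, |x - x'| ≤ C → |y - y'| ≤ C →
        |(π α * x + (1 - π α) * y) - (π α * x' + (1 - π α) * y')| ≤ C := by
      intro x y x' y' hx hy
      rw [abs_le] at hx hy ⊢
      constructor <;> nlinarith
    rw [textExpectation_succ, sum_mul_eq_of_forall_ne hπ α (v := missCost s false +
      textExpectation π n (fun W => ((s.next false).mispredictions
        (mainLoop (List.replicate (M + 1) α) B (0 : ℕ) nb W).2 : ℝ))) (fun a ha => by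
      simp only [mainLoop_replicate_cons_of_ne hB ha hi, cast_mispredictions_cons,
        textExpectation_add_const hπ])]
    have ih0 := ih (Nat.zero_le M) nb (s.next false)
    rcases hi.lt_or_eq with hlt | rfl
    · simp only [mainLoop_replicate_cons_self_of_lt hlt, cast_mispredictions_cons,
        textExpectation_add_const hπ]
      have ih1 := ih (Nat.succ_le_of_lt hlt) nb (s.next false)
      refine le_trans (le_of_eq (congrArg abs ?_)) (key ih1 ih0)
      have := hh.of_lt i hlt s
      push_cast
      linear_combination -this
    · simp only [mainLoop_replicate_cons_self hBM, cast_mispredictions_cons,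
        textExpectation_add_const hπ]
      have ih1 := ih le_rfl (nb + 1) (s.next true)
      refine le_trans (le_of_eq (congrArg abs ?_)) (key ih1 ih0)
      have := hh.last s
      push_cast
      linear_combination -this

theorem isEquivalent_mul_natCast {u : ℕ → ℝ} {g C : ℝ} (hg : 0 < g)
    (hu : ∀ n : ℕ, |u n - n * g| ≤ C) :
    Asymptotics.IsEquivalent Filter.atTop u (fun n : ℕ => g * (n : ℝ)) := by
  have h1 : (fun n : ℕ => u n - g * n) =O[Filter.atTop] (fun _ => (1 : ℝ)) :=
    Asymptotics.IsBigO.of_bound C (Filter.Eventually.of_forall fun n => by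
      simpa [mul_comm g] using hu n)
  refine h1.trans_isLittleO ?_
  rw [Asymptotics.isLittleO_const_left]
  right
  exact Filter.tendsto_abs_atTop_atTop.comp (tendsto_natCast_atTop_atTop.const_mul_atTop hg)

theorem IsPoissonSolution.isEquivalent {π : A → ℝ} (hπ_pos : ∀ a, 0 < π a)
    (hπ_lt : ∀ a, π a < 1) (hπ : ∑ a, π a = 1) {α : A} {M : ℕ} {g : ℝ} (hg : 0 < g)
    {h : ℕ → PredictorState → ℝ} (hh : IsPoissonSolution M (π α) g h) {B : FailureTable}
    (hB : ∀ i, -1 ≤ B.val i) (hBM : B.val (M + 1) = M) (s : PredictorState) :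
    Asymptotics.IsEquivalent Filter.atTop
      (fun n : ℕ => expectedCounterMispredictions π (List.replicate (M + 1) α) B s n)
      (fun n : ℕ => g * (n : ℝ)) := by
  obtain ⟨C, hC⟩ := exists_forall_abs_le M h
  -- One `C` for the deviation, one for the potential of the initial state.
  refine isEquivalent_mul_natCast (C := C + C) hg fun n => ?_
  have h1 := hh.abs_textExpectation_sub_le hπ_pos hπ_lt hπ hC hB hBM n (Nat.zero_le M) 0 s
  have h2 := hC 0 (Nat.zero_le M) s
  simp only [expectedCounterMispredictions, counterMispredictions, find]
  rw [Nat.cast_zero] at h1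
  rw [abs_le] at h1 h2 ⊢
  constructor <;> linarith

end Poisson

/-! ### Solutions of the Poisson equation -/

section Solutions

variable {p : ℝ}

theorem one_sub_two_mul_pos : 0 < 1 - 2 * p * (1 - p) := by
  nlinarith [sq_nonneg (2 * p - 1)]

theorem one_sub_cube_add_pow_four_pos (hp : 0 < p) (hp1 : p < 1) : 0 < 1 - p ^ 3 + p ^ 4 := by
  have h : p ^ 3 < 1 := pow_lt_one₀ hp.le hp1 (by norm_num)
  linarith [pow_pos hp 4]

theorem kappa_pos (m : ℕ) (hp : 0 < p) (hp1 : p < 1) : 0 < kappa m p := by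
  have hq : 0 < 1 - p := sub_pos.2 hp1
  have h3 : 0 < 1 - p ^ 3 := sub_pos.2 (pow_lt_one₀ hp.le hp1 (by norm_num))
  unfold kappa
  split_ifs
  · exact div_pos (mul_pos hp hq) one_sub_two_mul_pos
  · refine div_pos (mul_pos (by positivity) ?_) (one_sub_cube_add_pow_four_pos hp hp1)
    nlinarith [sq_nonneg p]
  · positivity

/-- The potential for the pattern `α`, with mean cost `g`. -/
noncomputable def potentialOne (p g : ℝ) : PredictorState → ℝ
  | stronglyNotTaken => 0
  | weaklyNotTaken => g / p - 1
  | weaklyTaken => (g / p - 1 + g) / p - 1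
  | stronglyTaken => (g / p - 1 + g) / p - g / (1 - p)

/-- The potential is `0` at the leftmost state, and three of the four equations give the other
values in terms of `g`. The equation left over, at `weaklyTaken`, determines `g`. -/
theorem isPoissonSolution_one (hp : 0 < p) (hp1 : p < 1) :
    IsPoissonSolution 0 p (kappa 1 p) (fun _ => potentialOne p (kappa 1 p)) := by
  have hq : 1 - p ≠ 0 := (sub_pos.2 hp1).ne'
  have hp0 := hp.ne'
  have hd : 1 - 2 * p * (1 - p) ≠ 0 := one_sub_two_mul_pos.ne'
  refine ⟨fun i hi => absurd hi (Nat.not_lt_zero i), fun s => ?_⟩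
  have hg : kappa 1 p = p * (1 - p) / (1 - 2 * p * (1 - p)) := by simp [kappa]
  cases s <;> simp only [potentialOne, missCost, next, prediction, reduceCtorEq, if_true, if_false]
  · field_simp
    ring
  · field_simp
    ring
  · have hgd : kappa 1 p * (1 - 2 * p * (1 - p)) = p * (1 - p) := by
      rw [hg, div_mul_cancel₀ _ hd]
    field_simp
    linear_combination hgd
  · field_simp
    ring

/-- The potential for the pattern `α α`, with mean cost `g`. -/
noncomputable def potentialTwo (p g : ℝ) : ℕ → PredictorState → ℝ
  | 0, stronglyNotTaken => 0
  | 0, weaklyNotTaken => 0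
  | 0, weaklyTaken => 1 + p * ((g / p + g) / p - 1) - g
  | 0, stronglyTaken => 1 + p * (((g / p + g) / p - 1 + g) / p - 1) +
      (1 - p) * (1 + p * ((g / p + g) / p - 1) - g) - g
  | _ + 1, stronglyNotTaken => g / p
  | _ + 1, weaklyNotTaken => (g / p + g) / p - 1
  | _ + 1, weaklyTaken => ((g / p + g) / p - 1 + g) / p - 1
  | _ + 1, stronglyTaken => 2 + p * ((g / p + g) / p - 1) - g - g / (1 - p)

theorem isPoissonSolution_two (hp : 0 < p) (hp1 : p < 1) :
    IsPoissonSolution 1 p (kappa 2 p) (potentialTwo p (kappa 2 p)) := by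
  have hq : 1 - p ≠ 0 := (sub_pos.2 hp1).ne'
  have hp0 := hp.ne'
  have hd : 1 - p ^ 3 + p ^ 4 ≠ 0 := (one_sub_cube_add_pow_four_pos hp hp1).ne'
  have hg : kappa 2 p = p ^ 2 * (1 - p) * (1 + 2 * p + p ^ 2 - p ^ 3) / (1 - p ^ 3 + p ^ 4) := by
    simp [kappa]
  refine ⟨fun i hi s => ?_, fun s => ?_⟩
  · obtain rfl : i = 0 := by omega
    cases s <;>
      simp only [potentialTwo, missCost, next, prediction, reduceCtorEq, if_true, if_false]
    all_goals
      field_simp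
      try ring
  · cases s <;>
      simp only [potentialTwo, missCost, next, prediction, reduceCtorEq, if_true, if_false]
    · field_simp
      ring
    · field_simp
      ring
    -- The only equation not used to define the potential: it fixes `g`.
    · rw [hg]
      field_simp
      ring
    · field_simp
      ring

/-- The potential for a pattern `α ^ m` with `m ≥ 3`, when `k + 1` more letters `α` would complete
an occurrence. -/
noncomputable def potentialThree (p : ℝ) : ℕ → PredictorState → ℝ
  | 0, stronglyNotTaken => p * (1 + p) ^ 2
  | 0, weaklyNotTaken => 2 * p + p ^ 2
  | 0, weaklyTaken => 1 + p
  | 0, stronglyTaken => 2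
  | 1, weaklyTaken => p ^ 2 * (1 + p) ^ 2 + 1 + p * (p - p ^ 2 - p ^ 3)
  | 1, stronglyTaken => p ^ 2 * (1 + p) ^ 2 + 2 - p + p * (1 + p - p * (1 + p) ^ 2)
  | 2, stronglyTaken => p ^ 3 * (1 + p) ^ 2 + 2 + p ^ 2 * (p - p ^ 2 - p ^ 3)
  | k + 3, stronglyTaken => p ^ (k + 4) * (1 + p) ^ 2 + 2
  | k + 2, weaklyTaken => p ^ (k + 3) * (1 + p) ^ 2 + 1
  | k + 1, stronglyNotTaken => p ^ (k + 2) * (1 + p) ^ 2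
  | k + 1, weaklyNotTaken => p ^ (k + 2) * (1 + p) ^ 2

/-- Far from an occurrence, the potential adds the cost `0`, `1` or `2` of driving the predictor
back to "not taken" and the probability `p ^ (k + 1)` of completing the run times its mean cost `(1
+ p) ^ 2`. Close to one, the predictor may not have settled, hence the exceptional values. -/
theorem isPoissonSolution_three (p : ℝ) (N : ℕ) :
    IsPoissonSolution (N + 2) p (kappa (N + 3) p) (fun i => potentialThree p (N + 2 - i)) := by
  have hg : kappa (N + 3) p = p ^ (N + 3) * (1 - p) * (1 + p) ^ 2 := by simp [kappa]
  refine ⟨fun i hi s => ?_, fun s => ?_⟩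
  · obtain ⟨k, hk⟩ : ∃ k, N + 2 - i = k + 1 := ⟨N + 1 - i, by omega⟩
    have hk' : N + 2 - (i + 1) = k := by omega
    simp only [hk, hk', hg, Nat.sub_zero]
    rcases k with _ | _ | _ | k <;> cases s <;>
      simp only [potentialThree, missCost, next, prediction, reduceCtorEq, if_true, if_false,
        Nat.succ_eq_add_one, Nat.zero_eq] <;>
      ring
  · simp only [hg, Nat.sub_zero, Nat.sub_self]
    cases s <;>
      simp only [potentialThree, missCost, next, prediction, reduceCtorEq, if_true, if_false] <;>
      ring

theorem exists_isPoissonSolution (M : ℕ) (hp : 0 < p) (hp1 : p < 1) :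
    ∃ h, IsPoissonSolution M p (kappa (M + 1) p) h :=
  match M with
  | 0 => ⟨_, isPoissonSolution_one hp hp1⟩
  | 1 => ⟨_, isPoissonSolution_two hp hp1⟩
  | N + 2 => ⟨_, isPoissonSolution_three p N⟩

end Solutions

end PatternMatching

theorem mainTheorem3 {A : Type*} [Fintype A] [DecidableEq A]
    (π : A → ℝ) (hπ_pos : ∀ a, 0 < π a) (hπ_lt : ∀ a, π a < 1) (hπ_sum : ∑ a, π a = 1)
    (α : A) (m : ℕ) (hm : 1 ≤ m) (s : PatternMatching.PredictorState) :
    Asymptotics.IsEquivalent Filter.atTop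
      (fun n : ℕ => PatternMatching.expectedCounterMispredictions π
        (List.replicate m α) (PatternMatching.mpTable (List.replicate m α)) s n)
      (fun n : ℕ => PatternMatching.kappa m (π α) * (n : ℝ)) ∧
    Asymptotics.IsEquivalent Filter.atTop
      (fun n : ℕ => PatternMatching.expectedCounterMispredictions π
        (List.replicate m α) (PatternMatching.kmpTable (List.replicate m α)) s n)
      (fun n : ℕ => PatternMatching.kappa m (π α) * (n : ℝ)) := by

  obtain ⟨M, rfl⟩ : ∃ M, m = M + 1 := ⟨m - 1, by omega⟩
  obtain ⟨h, hh⟩ := PatternMatching.exists_isPoissonSolution M (hπ_pos α) (hπ_lt α)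
  have hκ := PatternMatching.kappa_pos (M + 1) (hπ_pos α) (hπ_lt α)
  exact ⟨hh.isEquivalent hπ_pos hπ_lt hπ_sum hκ
      (fun _ => PatternMatching.neg_one_le_optLength _)
      (PatternMatching.mpTable_replicate_val_length α M) s,
    hh.isEquivalent hπ_pos hπ_lt hπ_sum hκ
      (fun _ => PatternMatching.neg_one_le_optLength _)
      (PatternMatching.kmpTable_replicate_val_length α M) s⟩
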